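/- Let $m\ge 1$ and $n\ge 0$ be integers. For a complex polynomial $P$ of degree $n$ and an $m$-tuple $\Lambda=(\lambda_1,\dots,\lambda_m)$ of complex numbers, let $D_P(\Lambda)=(c_{ij})_{1\le i\le m,\,0\le j\le n}$ be the $m\times(n+1)$ matrix with $c_{ij}=1$ if $P^{(j)}(\lambda_i)=0$ and $c_{ij}=0$ otherwise, and let $\mathcal D_n(\Lambda)=\{D_P(\Lambda) : P\in\mathbb C[x],\ \deg P=n\}$. Call $\Lambda$ affinely algebraically independent if the only polynomial $Q\in\mathbb Q[x_1,\dots,x_m]$ with $Q(a+b\lambda_1,\dots,a+b\lambda_m)=0$ for all $a,b\in\mathbb C$ is $Q=0$. Affinely algebraically independent $m$-tuples exist, and $\mathcal D_n(\Lambda)$ is the same set for all of them; denote it by $\mathcal D_n^{\mathrm{gen}(m)}$. Then, for $0\le k\le n+1$, the number of elements of $\mathcal D_n^{\mathrm{gen}(m)}$ with exactly $k$ ones is \[\frac{n+1-k}{n+1}\binom{(n+1)m}{k},\] no element of $\mathcal D_n^{\mathrm{gen}(m)}$ has more than $n$ ones, and \[\left|\mathcal D_n^{\mathrm{gen}(m)}\right|=\binom{(n+1)m-1}{n}-(m-2)\sum_{k=0}^{n-1}\binom{(n+1)m-1}{k}.\]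 -/

import Mathlib

open Polynomial

/-- The dope matrix `D_P(Λ)` : the `m × (n+1)` matrix whose `(i,j)` entry is `1` if
`P^{(j)}(λ_i) = 0` and `0` otherwise (columns indexed by `j = 0, …, n`). -/
noncomputable def dopeMatrix {m : ℕ} (n : ℕ) (P : ℂ[X]) (Λ : Fin m → ℂ) :
    Matrix (Fin m) (Fin (n + 1)) ℕ :=
  open Classical in
  Matrix.of fun i j => if (derivative^[(j : ℕ)] P).eval (Λ i) = 0 then 1 else 0

/-- `D_n(Λ)` : the set of dope matrices with respect to `Λ` of polynomials of degree exactly `n`. -/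
def dopeSet {m : ℕ} (n : ℕ) (Λ : Fin m → ℂ) : Set (Matrix (Fin m) (Fin (n + 1)) ℕ) :=
  {M | ∃ P : ℂ[X], P.degree = (n : WithBot ℕ) ∧ M = dopeMatrix n P Λ}

/-- `Λ` is affinely algebraically independent: the only rational polynomial that vanishes at
`(a + b λ_1, …, a + b λ_m)` for all complex `a, b` is the zero polynomial.
(The polynomials `x_i - x_j` show that the entries of such a tuple are distinct.) -/
def AffinelyAlgebraicallyIndependent {m : ℕ} (Λ : Fin m → ℂ) : Prop :=
  ∀ Q : MvPolynomial (Fin m) ℚ,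
    (∀ a b : ℂ, MvPolynomial.aeval (fun i => a + b * Λ i) Q = 0) → Q = 0

/-- The set of generic `m × (n+1)` dope matrices: those in `D_n(Λ)` for an affinely algebraically
independent `m`-tuple `Λ`. -/
def genericDopeSet (m n : ℕ) : Set (Matrix (Fin m) (Fin (n + 1)) ℕ) :=
  {M | ∃ Λ : Fin m → ℂ, AffinelyAlgebraicallyIndependent Λ ∧ M ∈ dopeSet n Λ}

/-- The number of entries of `M` that are equal to `1`. -/
def numOnes {m n : ℕ} (M : Matrix (Fin m) (Fin n) ℕ) : ℕ :=
  (Finset.univ.filter fun p : Fin m × Fin n => M p.1 p.2 = 1).card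

/-! At generic nodes, Birkhoff interpolation behaves as counting predicts. For polynomials of degree
`< j` subject to conditions `P^{(b)}(λ_l) = 0`, the solution space has dimension at least `i` minus
the number of conditions of order `< i`, for every `i ≤ j`. For affinely algebraically independent
nodes it has at most the maximum of these numbers
(`AffinelyAlgebraicallyIndependent.finrank_vanishingSubmodule_le`).

The upper bound is first achieved at special nodes, chosen one at a time, each far out on the real
axis. There leading terms dominate, and what remains is the independence of falling factorials,
which is Pólya's two-point criterion and hence Rolle's theorem. Minors are rational polynomials in
the nodes and solution dimensions are affinely invariant, so generic nodes do no worse.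

It follows that the generic dope matrices are exactly the sparse ones (`IsSparse`). Removing the
first column gives a recursion for their number, solved by Vandermonde's identity; Pascal's rule
makes the total telescope. -/

/-! ### Pólya's criterion at two nodes. -/

/-- Rolle: consecutive zeros in `[0, 1]` enclose a zero of the derivative in the open interval.
Zeros are counted without multiplicity. -/
theorem card_roots_Icc_le_card_roots_Ioo_derivative_add_one (p : ℝ[X]) (hp : derivative p ≠ 0) :
    (p.roots.toFinset.filter (· ∈ Set.Ioo (0 : ℝ) 1)).card + (if p.eval 0 = 0 then 1 else 0) +
      (if p.eval 1 = 0 then 1 else 0) ≤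
      ((derivative p).roots.toFinset.filter (· ∈ Set.Ioo (0 : ℝ) 1)).card + 1 := by
  have hp0 : p ≠ 0 := by rintro rfl; simp at hp
  set Z := p.roots.toFinset.filter (· ∈ Set.Ioo (0 : ℝ) 1) with hZ
  have h1 : Z.card + (if p.eval 0 = 0 then 1 else 0) + (if p.eval 1 = 0 then 1 else 0) ≤
      (p.roots.toFinset.filter (· ∈ Set.Icc (0 : ℝ) 1)).card := by
    have h0Z : (0 : ℝ) ∉ Z := by simp [hZ]
    have h1Z : (1 : ℝ) ∉ Z := by simp [hZ]
    have hsub : Z ⊆ p.roots.toFinset.filter (· ∈ Set.Icc (0 : ℝ) 1) := by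
      intro x hx
      simp only [hZ, Finset.mem_filter, Set.mem_Ioo, Set.mem_Icc] at hx ⊢
      exact ⟨hx.1, hx.2.1.le, hx.2.2.le⟩
    have mem0 (h : p.eval 0 = 0) : (0 : ℝ) ∈ p.roots.toFinset.filter (· ∈ Set.Icc (0 : ℝ) 1) := by
      simp [hp0, h]
    have mem1 (h : p.eval 1 = 0) : (1 : ℝ) ∈ p.roots.toFinset.filter (· ∈ Set.Icc (0 : ℝ) 1) := by
      simp [hp0, h]
    split_ifs with h0 h1 h1
    · rw [← Finset.card_insert_of_notMem h0Z,
        ← Finset.card_insert_of_notMem (a := (1 : ℝ)) (by simp [h1Z])]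
      exact Finset.card_le_card
        (Finset.insert_subset (mem1 h1) (Finset.insert_subset (mem0 h0) hsub))
    · rw [← Finset.card_insert_of_notMem h0Z]
      exact Finset.card_le_card (Finset.insert_subset (mem0 h0) hsub)
    · rw [add_zero, ← Finset.card_insert_of_notMem h1Z]
      exact Finset.card_le_card (Finset.insert_subset (mem1 h1) hsub)
    · exact Finset.card_le_card hsub
  refine h1.trans (Finset.card_le_of_interleaved fun x hx y hy hxy _ => ?_)
  simp only [Finset.mem_filter, Multiset.mem_toFinset, mem_roots hp0, IsRoot.def,
    Set.mem_Icc] at hx hy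
  obtain ⟨z, hz, hz'⟩ := exists_deriv_eq_zero hxy p.continuousOn (hx.1.trans hy.1.symm)
  refine ⟨z, ?_, hz.1, hz.2⟩
  simp only [Finset.mem_filter, Multiset.mem_toFinset, mem_roots hp, IsRoot.def, Set.mem_Ioo]
  exact ⟨by simpa using hz', hx.2.1.trans_lt hz.1, hz.2.trans_le hy.2.2⟩

theorem iterate_derivative_ne_zero_of_le_natDegree {p : ℝ[X]} (hp : p ≠ 0) {j : ℕ}
    (hj : j ≤ p.natDegree) : derivative^[j] p ≠ 0 := by
  intro h
  have := coeff_iterate_derivative (k := j) p (p.natDegree - j)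
  rw [h, Nat.sub_add_cancel hj, coeff_zero, nsmul_eq_mul, eq_comm, mul_eq_zero] at this
  rcases this with h | h
  · rw [Nat.cast_eq_zero, Nat.descFactorial_eq_zero_iff_lt] at h
    omega
  · exact hp (leadingCoeff_eq_zero.1 h)

/-- The two-point case of Pólya's criterion for Birkhoff interpolation. -/
theorem eq_zero_of_two_point_polya (p : ℝ[X])
    (h : ∀ j, j + 1 ≤ ((Finset.range (j + 1)).filter fun i => (derivative^[i] p).eval 0 = 0).card +
      ((Finset.range (j + 1)).filter fun i => (derivative^[i] p).eval 1 = 0).card) : p = 0 := by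
  by_contra hp
  -- Rolle at each order turns endpoint conditions into interior zeros. At `j = p.natDegree` the
  -- derivative is a nonzero constant, so at most `p.natDegree` conditions of order up to the degree
  -- can hold, one fewer than `h` demands.
  have key : ∀ j ≤ p.natDegree,
      ((Finset.range j).filter fun i => (derivative^[i] p).eval 0 = 0).card +
      ((Finset.range j).filter fun i => (derivative^[i] p).eval 1 = 0).card ≤
      ((derivative^[j] p).roots.toFinset.filter (· ∈ Set.Ioo (0 : ℝ) 1)).card + j := by
    intro j
    induction j with
    | zero => simp
    | succ j ih =>
      intro hj
      have h1 := ih (by omega)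
      have h2 := card_roots_Icc_le_card_roots_Ioo_derivative_add_one (derivative^[j] p) (by
        rw [← Function.iterate_succ_apply' derivative]
        exact iterate_derivative_ne_zero_of_le_natDegree hp hj)
      rw [← Function.iterate_succ_apply' derivative, Nat.succ_eq_add_one] at h2
      have h3 (x : ℝ) :
          ((Finset.range (j + 1)).filter fun i => (derivative^[i] p).eval x = 0).card =
          ((Finset.range j).filter fun i => (derivative^[i] p).eval x = 0).card +
            if (derivative^[j] p).eval x = 0 then 1 else 0 := by
        rw [Finset.card_filter, Finset.card_filter, Finset.sum_range_succ]
      rw [h3, h3]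
      omega
  have h1 := key _ le_rfl
  have h2 := h p.natDegree
  obtain ⟨c, hc⟩ : ∃ c, derivative^[p.natDegree] p = C c := by
    refine ⟨_, eq_C_of_natDegree_eq_zero ?_⟩
    have := natDegree_iterate_derivative p p.natDegree
    omega
  have hc0 : c ≠ 0 := by
    rintro rfl
    exact iterate_derivative_ne_zero_of_le_natDegree hp le_rfl (by simpa using hc)
  rw [Finset.range_add_one, Finset.filter_insert, Finset.filter_insert, hc] at h2
  rw [hc] at h1
  simp [hc0] at h1 h2
  omega

/-- The sums are the derivatives at `1` of `∑ g d X^d`, whose derivatives at `0` of orders outside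
`S` vanish too. The hypothesis on `S` and `B` is exactly what two-point Pólya needs. -/
theorem eq_zero_of_sum_mul_descFactorial_eq_zero {S B : Finset ℕ}
    (h : ∀ i, (S.filter (· < i)).card ≤ (B.filter (· < i)).card) (g : ℕ → ℝ)
    (hg : ∀ b ∈ B, ∑ d ∈ S, g d * (d.descFactorial b : ℝ) = 0) : ∀ d ∈ S, g d = 0 := by
  set p : ℝ[X] := ∑ d ∈ S, C (g d) * X ^ d with hp
  have hD (i : ℕ) : derivative^[i] p =
      ∑ d ∈ S, C (g d) * (C (d.descFactorial i : ℝ) * X ^ (d - i)) := by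
    rw [hp, iterate_derivative_sum]
    refine Finset.sum_congr rfl fun d _ => ?_
    rw [iterate_derivative_C_mul, iterate_derivative_X_pow_eq_C_mul]
  have hp0 : p = 0 := by
    refine eq_zero_of_two_point_polya p fun j => ?_
    have h1 : (B.filter (· < j + 1)).card ≤
        ((Finset.range (j + 1)).filter fun i => (derivative^[i] p).eval 1 = 0).card := by
      refine Finset.card_le_card fun b hb => ?_
      rw [Finset.mem_filter] at hb
      rw [Finset.mem_filter, Finset.mem_range, hD]
      refine ⟨hb.2, ?_⟩
      rw [eval_finsetSum, ← hg b hb.1]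
      exact Finset.sum_congr rfl fun d _ => by simp
    have h0 : (Finset.range (j + 1) \ S.filter (· < j + 1)).card ≤
        ((Finset.range (j + 1)).filter fun i => (derivative^[i] p).eval 0 = 0).card := by
      refine Finset.card_le_card fun i hi => ?_
      simp only [Finset.mem_sdiff, Finset.mem_range, Finset.mem_filter, not_and] at hi ⊢
      refine ⟨hi.1, ?_⟩
      have hiS : i ∉ S := fun hS => hi.2 hS hi.1
      rw [hD, eval_finsetSum]
      refine Finset.sum_eq_zero fun d hd => ?_
      rcases lt_trichotomy d i with hlt | rfl | hlt
      · simp [Nat.descFactorial_of_lt hlt]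
      · exact absurd hd hiS
      · simp [Nat.sub_ne_zero_of_lt hlt]
    have h2 := Finset.le_card_sdiff (S.filter (· < j + 1)) (Finset.range (j + 1))
    have h3 := h (j + 1)
    rw [Finset.card_range] at h2
    omega
  intro d hd
  have := congrArg (coeff · d) hp0
  simpa [hp, coeff_X_pow, hd] using this

theorem linearIndependent_descFactorial {S B : Finset ℕ}
    (h : ∀ i, (S.filter (· < i)).card ≤ (B.filter (· < i)).card) :
    LinearIndependent ℂ fun (d : S) (b : B) => ((d : ℕ).descFactorial b : ℂ) := by
  rw [Fintype.linearIndependent_iff]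
  intro g hg d
  have hsum (b : ℕ) (hb : b ∈ B) : ∑ d : S, g d * ((d : ℕ).descFactorial b : ℂ) = 0 := by
    simpa [Finset.sum_apply] using congrFun hg ⟨b, hb⟩
  have aux (φ : ℂ →+ ℝ) (hφ : ∀ z (k : ℕ), φ (z * k) = φ z * k) : φ (g d) = 0 := by
    have := eq_zero_of_sum_mul_descFactorial_eq_zero h
      (fun d => if hd : d ∈ S then φ (g ⟨d, hd⟩) else 0) (fun b hb => by
        have := congrArg φ (hsum b hb)
        rw [map_sum, map_zero] at this
        rw [← this, ← Finset.sum_coe_sort S]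
        exact Finset.sum_congr rfl fun d _ => by rw [hφ]; simp) d d.2
    simpa using this
  exact Complex.ext (aux Complex.reAddGroupHom (by simp)) (aux Complex.imAddGroupHom (by simp))

/-! ### Derivative data at a distant node. -/

theorem tendsto_eval_div_pow {Q : ℂ[X]} {k : ℕ} (hQ : Q.natDegree ≤ k) :
    Filter.Tendsto (fun t : ℝ => Q.eval (t : ℂ) / (t : ℂ) ^ k) Filter.atTop (nhds (Q.coeff k)) := by
  have hlim : Filter.Tendsto (fun t : ℝ => ∑ l ∈ Finset.range (k + 1), Q.coeff l *
      ((t : ℂ)⁻¹) ^ (k - l)) Filter.atTop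
      (nhds (∑ l ∈ Finset.range (k + 1), Q.coeff l * (0 : ℂ) ^ (k - l))) := by
    refine tendsto_finsetSum _ fun l _ => Filter.Tendsto.const_mul _ (Filter.Tendsto.pow ?_ _)
    have := (Complex.continuous_ofReal.tendsto 0).comp (tendsto_inv_atTop_zero (𝕜 := ℝ))
    simpa [Function.comp_def] using this
  rw [Finset.sum_range_succ, Finset.sum_eq_zero, zero_add, Nat.sub_self, pow_zero, mul_one] at hlim
  · refine hlim.congr' ?_
    filter_upwards [Filter.eventually_gt_atTop 0] with t ht
    have ht' : (t : ℂ) ≠ 0 := by exact_mod_cast ht.ne'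
    rw [eval_eq_sum_range' (Nat.lt_succ_of_le hQ), Finset.sum_div, Finset.sum_congr rfl]
    intro l hl
    rw [inv_pow, mul_div_assoc, pow_sub₀ _ ht' (Nat.lt_succ_iff.1 (Finset.mem_range.1 hl))]
    field_simp
  · intro l hl
    rw [zero_pow (by have := Finset.mem_range.1 hl; omega), mul_zero]

/-- Hermite-type data at a node far away is independent on polynomials of distinct degrees
as soon as the degrees and the orders of the derivatives satisfy Pólya's condition. -/
theorem eventually_linearIndependent_eval_iterate_derivative {S B : Finset ℕ}
    (h : ∀ i, (S.filter (· < i)).card ≤ (B.filter (· < i)).card) (P : S → ℂ[X])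
    (hP : ∀ d, (P d).natDegree ≤ d) (hP1 : ∀ d, (P d).coeff d = 1) :
    ∀ᶠ t : ℝ in Filter.atTop, LinearIndependent ℂ
      fun (d : S) (b : B) => (derivative^[(b : ℕ)] (P d)).eval (t : ℂ) := by
  -- Scaling entry `(d, b)` by `t^b / t^d` preserves independence and leaves only leading terms in
  -- the limit. Independence is an open condition, so it passes from the limit to large `t`.
  have hlim : Filter.Tendsto (fun (t : ℝ) (d : S) (b : B) =>
      (derivative^[(b : ℕ)] (P d)).eval (t : ℂ) * (t : ℂ) ^ (b : ℕ) / (t : ℂ) ^ (d : ℕ))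
      Filter.atTop (nhds fun (d : S) (b : B) => ((d : ℕ).descFactorial b : ℂ)) := by
    refine tendsto_pi_nhds.2 fun d => tendsto_pi_nhds.2 fun b => ?_
    have hdeg : (derivative^[(b : ℕ)] (P d)).natDegree ≤ d - b :=
      (natDegree_iterate_derivative _ _).trans (Nat.sub_le_sub_right (hP d) _)
    rcases le_or_gt (b : ℕ) d with hbd | hbd
    · have := tendsto_eval_div_pow hdeg
      rw [coeff_iterate_derivative, Nat.sub_add_cancel hbd, hP1, nsmul_one] at this
      refine this.congr' ?_
      filter_upwards [Filter.eventually_gt_atTop 0] with t ht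
      have ht' : (t : ℂ) ≠ 0 := by exact_mod_cast ht.ne'
      rw [pow_sub₀ _ ht' hbd]
      field_simp
    · rw [Nat.descFactorial_of_lt hbd, Nat.cast_zero,
        iterate_derivative_eq_zero ((hP d).trans_lt hbd)]
      simp
  have hev := hlim.eventually
    ((isOpen_setOfPred_linearIndependent (𝕜 := ℂ)).mem_nhds (linearIndependent_descFactorial h))
  filter_upwards [hev, Filter.eventually_gt_atTop 0] with t ht ht0
  have ht' : (t : ℂ) ≠ 0 := by exact_mod_cast ht0.ne'
  rw [Fintype.linearIndependent_iff]
  intro g hg d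
  have := Fintype.linearIndependent_iff.1 ht (fun d => g d * (t : ℂ) ^ (d : ℕ)) (by
    funext b
    have hb := congrFun hg b
    simp only [Finset.sum_apply, Pi.smul_apply, smul_eq_mul, Pi.zero_apply] at hb ⊢
    rw [← zero_mul ((t : ℂ) ^ (b : ℕ)), ← hb, Finset.sum_mul]
    refine Finset.sum_congr rfl fun d _ => ?_
    field_simp) d
  exact (mul_eq_zero.1 this).resolve_right (pow_ne_zero _ ht')

/-! ### Dimensions in the degree filtration. -/

theorem Submodule.finrank_inf_ker_add_finrank_range_domRestrict {K M N : Type*} [Field K]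
    [AddCommGroup M] [Module K M] [AddCommGroup N] [Module K N] (V : Submodule K M)
    [FiniteDimensional K V] (f : M →ₗ[K] N) :
    Module.finrank K ↥(V ⊓ LinearMap.ker f) +
      Module.finrank K (LinearMap.range (f.domRestrict V)) = Module.finrank K V := by
  rw [← LinearMap.finrank_range_add_finrank_ker (f.domRestrict V), add_comm]
  congr 1
  rw [← Submodule.finrank_map_subtype_eq V (LinearMap.ker (f.domRestrict V)),
    LinearMap.ker_domRestrict, Submodule.map_comap_subtype]

/-- The values at `t` of the derivatives of orders in `B`. -/
noncomputable def evalDerivatives (t : ℂ) (B : Finset ℕ) : ℂ[X] →ₗ[ℂ] (B → ℂ) :=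
  LinearMap.pi fun b => leval t ∘ₗ derivative ^ (b : ℕ)

theorem evalDerivatives_apply (t : ℂ) (B : Finset ℕ) (P : ℂ[X]) (b : B) :
    evalDerivatives t B P b = (derivative^[(b : ℕ)] P).eval t := by
  simp [evalDerivatives, Module.End.pow_apply]

theorem mem_ker_evalDerivatives {t : ℂ} {B : Finset ℕ} {P : ℂ[X]} :
    P ∈ LinearMap.ker (evalDerivatives t B) ↔ ∀ b ∈ B, (derivative^[b] P).eval t = 0 := by
  simp [LinearMap.mem_ker, funext_iff, evalDerivatives_apply]

instance finiteDimensional_inf_degreeLT (W : Submodule ℂ ℂ[X]) (i : ℕ) :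
    FiniteDimensional ℂ ↥(W ⊓ degreeLT ℂ i) :=
  have : FiniteDimensional ℂ (degreeLT ℂ i) := Module.Finite.equiv (degreeLTEquiv ℂ i).symm
  Submodule.finiteDimensional_of_le inf_le_right

open Classical in
theorem finrank_inf_degreeLT_succ (W : Submodule ℂ ℂ[X]) (i : ℕ) :
    Module.finrank ℂ ↥(W ⊓ degreeLT ℂ (i + 1)) = Module.finrank ℂ ↥(W ⊓ degreeLT ℂ i) +
      if ∃ P ∈ W, P.natDegree ≤ i ∧ P.coeff i = 1 then 1 else 0 := by
  rw [← Submodule.finrank_inf_ker_add_finrank_range_domRestrict (W ⊓ degreeLT ℂ (i + 1))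
    (lcoeff ℂ i)]
  have hker : W ⊓ degreeLT ℂ (i + 1) ⊓ LinearMap.ker (lcoeff ℂ i) = W ⊓ degreeLT ℂ i := by
    ext P
    simp only [Submodule.mem_inf, mem_degreeLT, LinearMap.mem_ker, lcoeff_apply, and_assoc,
      degree_lt_iff_coeff_zero]
    refine and_congr_right fun _ => ⟨fun h k hk => ?_, fun h => ⟨fun k hk => h k (by omega), h i le_rfl⟩⟩
    rcases hk.eq_or_lt with rfl | hk
    exacts [h.2, h.1 k hk]
  rw [hker]
  congr 1
  split_ifs with h
  · obtain ⟨P, hPW, hP, hP1⟩ := h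
    have : LinearMap.range ((lcoeff ℂ i).domRestrict (W ⊓ degreeLT ℂ (i + 1))) = ⊤ := by
      refine LinearMap.range_eq_top.2 (LinearMap.surjective ?_)
      intro h0
      have := LinearMap.congr_fun h0 ⟨P, hPW, mem_degreeLT.2
        ((degree_le_of_natDegree_le hP).trans_lt (by exact_mod_cast Nat.lt_succ_self i))⟩
      simp [hP1] at this
    rw [this, finrank_top, Module.finrank_self]
  · have : LinearMap.range ((lcoeff ℂ i).domRestrict (W ⊓ degreeLT ℂ (i + 1))) = ⊥ := by
      rw [LinearMap.range_eq_bot]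
      ext ⟨P, hP⟩
      simp only [LinearMap.domRestrict_apply, lcoeff_apply, LinearMap.zero_apply]
      by_contra hc
      refine h ⟨(P.coeff i)⁻¹ • P, W.smul_mem _ hP.1, ?_, by simp [hc]⟩
      refine (natDegree_smul_le _ _).trans ?_
      rw [natDegree_le_iff_coeff_eq_zero]
      exact fun k hk => (degree_lt_iff_coeff_zero _ _).1 (mem_degreeLT.1 hP.2) k hk
    rw [this, finrank_bot]

open Classical in
-- Each degree occurring in `W` contributes one dimension, so dimension bounds become counts of
-- degrees, the form Pólya's condition takes.
theorem finrank_inf_degreeLT_eq_card (W : Submodule ℂ ℂ[X]) (i : ℕ) :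
    Module.finrank ℂ ↥(W ⊓ degreeLT ℂ i) =
      ((Finset.range i).filter fun d => ∃ P ∈ W, P.natDegree ≤ d ∧ P.coeff d = 1).card := by
  induction i with
  | zero =>
    have : W ⊓ degreeLT ℂ 0 = ⊥ := by
      rw [eq_bot_iff]
      intro P hP
      simpa [mem_degreeLT] using hP.2
    rw [this, finrank_bot, Finset.range_zero, Finset.filter_empty, Finset.card_empty]
  | succ i ih =>
    rw [finrank_inf_degreeLT_succ, ih, Finset.range_add_one, Finset.filter_insert]
    split_ifs <;> simp

/-- For a node `t` far away the conditions `P^{(b)}(t) = 0`, `b ∈ B`, cut down `W` as much as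
the degrees of its elements allow. -/
theorem eventually_finrank_inf_ker_evalDerivatives_le (W : Submodule ℂ ℂ[X]) (B : Finset ℕ)
    (j r : ℕ) (h : ∀ i ≤ j,
      Module.finrank ℂ ↥(W ⊓ degreeLT ℂ i) ≤ r + (B.filter (· < i)).card) :
    ∀ᶠ t : ℝ in Filter.atTop, Module.finrank ℂ
      ↥((W ⊓ degreeLT ℂ j) ⊓ LinearMap.ker (evalDerivatives (t : ℂ) B)) ≤ r := by
  classical
  set w : ℕ → ℕ := fun i => Module.finrank ℂ ↥(W ⊓ degreeLT ℂ i) with hw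
  rcases le_or_gt (w j) r with hjr | hjr
  · refine Filter.Eventually.of_forall fun t => le_trans ?_ hjr
    exact Submodule.finrank_mono inf_le_left
  -- The filtration starts at `0` and grows by at most one per degree, so it takes the value `r`.
  -- Elements of degree below `c` account for the allowed `r` dimensions; the degrees in `S` must be
  -- eliminated by the conditions.
  obtain ⟨c, hcj, hc⟩ : ∃ c ≤ j, w c = r := by
    have hex : ∃ i, r < w i := ⟨j, hjr⟩
    have hle : Nat.find hex ≤ j := Nat.find_min' hex hjr
    have hspec : r < w (Nat.find hex) := Nat.find_spec hex
    rcases hn : Nat.find hex with _ | k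
    · rw [hn] at hspec
      simp [hw, finrank_inf_degreeLT_eq_card] at hspec
    · refine ⟨k, by omega, ?_⟩
      have h1 : ¬ r < w k := Nat.find_min hex (by omega)
      have h2 : w (k + 1) = w k + _ := finrank_inf_degreeLT_succ W k
      rw [hn] at hspec
      split_ifs at h2 <;> omega
  set S := (Finset.range j).filter fun d => c ≤ d ∧ ∃ P ∈ W, P.natDegree ≤ d ∧ P.coeff d = 1
    with hS
  have hScard (i : ℕ) (hi : i ≤ j) (hci : c ≤ i) : (S.filter (· < i)).card + r = w i := by
    rw [← hc]
    simp only [hw, finrank_inf_degreeLT_eq_card]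
    rw [← Finset.card_union_of_disjoint]
    · congr 1
      ext d
      simp only [hS, Finset.mem_union, Finset.mem_filter, Finset.mem_range]
      constructor
      · rintro (⟨⟨_, _, hd⟩, hdi⟩ | ⟨hdc, hd⟩)
        exacts [⟨hdi, hd⟩, ⟨by omega, hd⟩]
      · rintro ⟨hdi, hd⟩
        rcases lt_or_ge d c with hdc | hdc
        exacts [Or.inr ⟨hdc, hd⟩, Or.inl ⟨⟨by omega, hdc, hd⟩, hdi⟩]
    · rw [Finset.disjoint_left]
      intro d hd hd'
      simp only [hS, Finset.mem_filter, Finset.mem_range] at hd hd'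
      omega
  have hSj : S.filter (· < j) = S :=
    Finset.filter_true_of_mem fun d hd => Finset.mem_range.1 (Finset.mem_filter.1 hd).1
  have hpolya (i : ℕ) : (S.filter (· < i)).card ≤ (B.filter (· < i)).card := by
    rcases lt_or_ge i c with hic | hic
    · rw [Finset.filter_false_of_mem, Finset.card_empty]
      · exact Nat.zero_le _
      · intro d hd
        simp only [hS, Finset.mem_filter] at hd
        omega
    rcases le_or_gt i j with hij | hij
    · have h1 := h i hij
      have h2 := hScard i hij hic
      simp only [hw] at h2
      omega
    · have h1 := h j le_rfl
      have h2 := hScard j le_rfl hcj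
      have h3 : (B.filter (· < j)).card ≤ (B.filter (· < i)).card :=
        Finset.card_le_card (Finset.monotone_filter_right _ fun b _ hb => lt_trans hb hij)
      have h4 := Finset.card_filter_le S (· < i)
      rw [hSj] at h2
      simp only [hw] at h2
      omega
  choose P hPW hPd hP1 using fun d : S => (Finset.mem_filter.1 d.2).2.2
  filter_upwards [eventually_linearIndependent_eval_iterate_derivative hpolya P hPd hP1] with t ht
  have hmem (d : S) : P d ∈ W ⊓ degreeLT ℂ j := by
    refine ⟨hPW d, mem_degreeLT.2 ?_⟩
    have := Finset.mem_range.1 (Finset.mem_filter.1 d.2).1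
    exact (degree_le_of_natDegree_le (hPd d)).trans_lt (by exact_mod_cast this)
  -- The conditions have rank at least `S.card = w j - r`, leaving a kernel of dimension at most
  -- `r`.
  have hLI : LinearIndependent ℂ fun d : S =>
      (⟨evalDerivatives (t : ℂ) B (P d), ⟨⟨P d, hmem d⟩, rfl⟩⟩ :
        LinearMap.range ((evalDerivatives (t : ℂ) B).domRestrict (W ⊓ degreeLT ℂ j))) := by
    refine LinearIndependent.of_comp (Submodule.subtype _) ?_
    convert ht using 2 with d
    funext b
    exact evalDerivatives_apply _ _ _ _
  have h1 := hLI.fintype_card_le_finrank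
  have h2 := Submodule.finrank_inf_ker_add_finrank_range_domRestrict (W ⊓ degreeLT ℂ j)
    (evalDerivatives (t : ℂ) B)
  have h3 := hScard j le_rfl hcj
  rw [hSj] at h3
  simp only [hw] at h3
  rw [Fintype.card_coe] at h1
  omega

/-! ### Special nodes attaining the counting bound. -/

/-- The polynomials of degree less than `j` whose derivatives of the orders in `B i` vanish at
`Λ i`, for every `i`. -/
noncomputable def vanishingSubmodule {m : ℕ} (Λ : Fin m → ℂ) (B : Fin m → Finset ℕ) (j : ℕ) :
    Submodule ℂ ℂ[X] :=
  (⨅ i, LinearMap.ker (evalDerivatives (Λ i) (B i))) ⊓ degreeLT ℂ j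

theorem mem_vanishingSubmodule {m : ℕ} {Λ : Fin m → ℂ} {B : Fin m → Finset ℕ} {j : ℕ} {P : ℂ[X]} :
    P ∈ vanishingSubmodule Λ B j ↔
      (∀ i, ∀ b ∈ B i, (derivative^[b] P).eval (Λ i) = 0) ∧ P.degree < j := by
  simp [vanishingSubmodule, Submodule.mem_iInf, mem_ker_evalDerivatives, mem_degreeLT,
    -LinearMap.mem_ker]

instance {m : ℕ} (Λ : Fin m → ℂ) (B : Fin m → Finset ℕ) (j : ℕ) :
    FiniteDimensional ℂ (vanishingSubmodule Λ B j) :=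
  finiteDimensional_inf_degreeLT _ _

theorem finrank_degreeLT (j : ℕ) : Module.finrank ℂ (degreeLT ℂ j) = j := by
  rw [(degreeLTEquiv ℂ j).finrank_eq, Module.finrank_fin_fun]

/-- Nodes are added one at a time, far out. The bound `N` leaves finitely many pairs `(j, r)`, so a
single node can serve all of them; the induction needs other pairs than the one being proved. -/
theorem exists_nodes_finrank_vanishingSubmodule_le {m : ℕ} (B : Fin m → Finset ℕ) (N : ℕ) :
    ∃ Λ : Fin m → ℂ, ∀ j ≤ N, ∀ r ≤ N, (∀ i ≤ j, i ≤ r + ∑ l, ((B l).filter (· < i)).card) →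
      Module.finrank ℂ (vanishingSubmodule Λ B j) ≤ r := by
  induction m with
  | zero =>
    refine ⟨Fin.elim0, fun j _ r _ h => ?_⟩
    have h1 := h j le_rfl
    have : vanishingSubmodule Fin.elim0 B j = degreeLT ℂ j := by simp [vanishingSubmodule]
    rw [this, finrank_degreeLT]
    simpa using h1
  | succ m ih =>
    obtain ⟨Λ, hΛ⟩ := ih fun l => B l.succ
    set W := ⨅ i, LinearMap.ker (evalDerivatives (Λ i) (B i.succ)) with hW
    have hev : ∀ᶠ t : ℝ in Filter.atTop, ∀ j ∈ Finset.range (N + 1), ∀ r ∈ Finset.range (N + 1),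
        (∀ i ≤ j, i ≤ r + ∑ l, ((B l).filter (· < i)).card) → Module.finrank ℂ
          ↥((W ⊓ degreeLT ℂ j) ⊓ LinearMap.ker (evalDerivatives (t : ℂ) (B 0))) ≤ r := by
      rw [Filter.eventually_all_finset]
      intro j hj
      rw [Filter.eventually_all_finset]
      intro r hr
      rw [Filter.eventually_imp_distrib_left]
      intro h
      refine eventually_finrank_inf_ker_evalDerivatives_le W (B 0) j r fun i hi => ?_
      rw [Finset.mem_range] at hj hr
      -- The conditions at the new node join `r` in the allowance for the old nodes. If that exceeds
      -- `N`, the trivial bound `i ≤ N` suffices.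
      by_cases hN : r + ((B 0).filter (· < i)).card ≤ N
      · refine hΛ i (by omega) _ hN fun k hk => (h k (by omega)).trans ?_
        rw [Fin.sum_univ_succ]
        have : ((B 0).filter (· < k)).card ≤ ((B 0).filter (· < i)).card :=
          Finset.card_le_card
            (Finset.monotone_filter_right _ fun b _ hb => lt_of_lt_of_le hb hk)
        omega
      · have : FiniteDimensional ℂ (degreeLT ℂ i) :=
          Module.Finite.equiv (degreeLTEquiv ℂ i).symm
        have h1 := Submodule.finrank_mono (inf_le_right : W ⊓ degreeLT ℂ i ≤ _)
        rw [finrank_degreeLT] at h1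
        omega
    obtain ⟨t, ht⟩ := hev.exists
    refine ⟨Fin.cons (t : ℂ) Λ, fun j hj r hr h => ?_⟩
    have := ht j (by simpa [Nat.lt_succ_iff] using hj) r (by simpa [Nat.lt_succ_iff] using hr) h
    convert this using 3
    all_goals
      ext P
      simp [vanishingSubmodule, Submodule.mem_iInf, Fin.forall_fin_succ, hW, -LinearMap.mem_ker]
      tauto

/-! ### From special nodes to generic ones. -/

/-- The matrix whose kernel describes the polynomials in `vanishingSubmodule x B j`. -/
def birkhoffMatrix {R : Type*} [CommRing R] {m : ℕ} (x : Fin m → R) (B : Fin m → Finset ℕ)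
    (j : ℕ) : Matrix (Σ i, B i) (Fin j) R :=
  Matrix.of fun p d => ((d : ℕ).descFactorial p.2 : R) * x p.1 ^ ((d : ℕ) - p.2)

theorem aeval_det_submatrix_birkhoffMatrix {m k : ℕ} (x : Fin m → ℂ) (B : Fin m → Finset ℕ) (j : ℕ)
    (f : Fin k → Σ i, B i) (g : Fin k → Fin j) :
    MvPolynomial.aeval x ((birkhoffMatrix (MvPolynomial.X (R := ℚ)) B j).submatrix f g).det =
      ((birkhoffMatrix x B j).submatrix f g).det := by
  rw [AlgHom.map_det]
  congr 1
  ext p d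
  rw [AlgHom.mapMatrix_apply, Matrix.map_apply]
  simp [birkhoffMatrix]

theorem finrank_vanishingSubmodule_add_rank {m : ℕ} (Λ : Fin m → ℂ) (B : Fin m → Finset ℕ)
    (j : ℕ) : Module.finrank ℂ (vanishingSubmodule Λ B j) + (birkhoffMatrix Λ B j).rank = j := by
  set φ : ℂ[X] →ₗ[ℂ] ((Σ i, B i) → ℂ) :=
    LinearMap.pi fun p => leval (Λ p.1) ∘ₗ derivative ^ (p.2 : ℕ) with hφ
  have hφa (P : ℂ[X]) (p : Σ i, B i) : φ P p = (derivative^[(p.2 : ℕ)] P).eval (Λ p.1) := by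
    simp [hφ, Module.End.pow_apply]
  have : FiniteDimensional ℂ (degreeLT ℂ j) := Module.Finite.equiv (degreeLTEquiv ℂ j).symm
  have h1 := Submodule.finrank_inf_ker_add_finrank_range_domRestrict (degreeLT ℂ j) φ
  have h2 : degreeLT ℂ j ⊓ LinearMap.ker φ = vanishingSubmodule Λ B j := by
    ext P
    simp only [Submodule.mem_inf, mem_degreeLT, LinearMap.mem_ker, funext_iff, hφa,
      mem_vanishingSubmodule, Sigma.forall, Subtype.forall, Pi.zero_apply]
    tauto
  have h3 : (birkhoffMatrix Λ B j).mulVecLin =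
      (φ.domRestrict (degreeLT ℂ j)) ∘ₗ (degreeLTEquiv ℂ j).symm.toLinearMap := by
    ext d p
    have : (((degreeLTEquiv ℂ j).symm (Pi.single d 1) : degreeLT ℂ j) : ℂ[X]) = X ^ (d : ℕ) := by
      change ∑ i : Fin j, monomial (i : ℕ) (Pi.single d (1 : ℂ) i) = _
      rw [Finset.sum_eq_single d]
      · simp [X_pow_eq_monomial]
      · intro i _ hi
        simp [hi]
      · simp
    simp [this, hφa, birkhoffMatrix, iterate_derivative_X_pow_eq_C_mul]
  rw [Matrix.rank, h3, LinearMap.range_comp_of_range_eq_top _ (LinearEquiv.range _), ← h2, h1,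
    finrank_degreeLT]

theorem Matrix.exists_linearIndependent_row_comp {K m n : Type*} [Field K] [Fintype m] [Fintype n]
    (A : Matrix m n K) : ∃ f : Fin A.rank → m, LinearIndependent K (A.submatrix f id).row := by
  rw [A.rank_eq_finrank_span_row]
  obtain ⟨v, hv, -, hLI⟩ := Submodule.exists_fun_fin_finrank_span_eq K (Set.range A.row)
  choose f hf using hv
  obtain rfl : (fun i => A.row (f i)) = v := funext hf
  exact ⟨f, hLI⟩

theorem Matrix.exists_submatrix_det_ne_zero {K m n : Type*} [Field K] [Fintype m] [Fintype n]
    (A : Matrix m n K) :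
    ∃ (f : Fin A.rank → m) (g : Fin A.rank → n), (A.submatrix f g).det ≠ 0 := by
  obtain ⟨f, hf⟩ := A.exists_linearIndependent_row_comp
  have hr : (A.submatrix f id).transpose.rank = A.rank := by
    rw [Matrix.rank_transpose, hf.rank_matrix, Fintype.card_fin]
  obtain ⟨g, hg⟩ := (A.submatrix f id).transpose.exists_linearIndependent_row_comp
  refine ⟨f, g ∘ Fin.cast hr.symm, ?_⟩
  rw [← Matrix.det_transpose, ← isUnit_iff_ne_zero, ← Matrix.isUnit_iff_isUnit_det,
    ← Matrix.linearIndependent_rows_iff_isUnit]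
  exact hg.comp (Fin.cast hr.symm) (Fin.cast_injective _)

theorem iterate_derivative_comp_linear (P : ℂ[X]) (c d : ℂ) (k : ℕ) :
    derivative^[k] (P.comp (C c * X + C d)) =
      C (c ^ k) * (derivative^[k] P).comp (C c * X + C d) := by
  induction k with
  | zero => simp
  | succ k ih =>
    rw [Function.iterate_succ_apply', ih, Function.iterate_succ_apply', derivative_C_mul,
      derivative_comp]
    simp [pow_succ]
    ring

/-- An affine change of variable multiplies a `k`-th derivative by a constant, so it carries
solutions to solutions. -/
theorem finrank_vanishingSubmodule_le_affine {m : ℕ} (Λ : Fin m → ℂ) (B : Fin m → Finset ℕ)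
    (j : ℕ) (a : ℂ) {b : ℂ} (hb : b ≠ 0) :
    Module.finrank ℂ (vanishingSubmodule Λ B j) ≤
      Module.finrank ℂ (vanishingSubmodule (fun i => a + b * Λ i) B j) := by
  have : Invertible b⁻¹ := invertibleOfNonzero (inv_ne_zero hb)
  set φ := (algEquivCMulXAddC b⁻¹ (-(b⁻¹ * a))).toLinearEquiv with hφ
  rw [← φ.finrank_map_eq]
  refine Submodule.finrank_mono ?_
  rintro _ ⟨P, hP, rfl⟩
  have hφP : φ P = P.comp (C b⁻¹ * X + C (-(b⁻¹ * a))) := by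
    rfl
  rw [SetLike.mem_coe, mem_vanishingSubmodule] at hP
  change φ P ∈ _
  rw [mem_vanishingSubmodule, hφP]
  refine ⟨fun i k hk => ?_, ?_⟩
  · rw [iterate_derivative_comp_linear, eval_mul, eval_comp]
    have : eval (a + b * Λ i) (C b⁻¹ * X + C (-(b⁻¹ * a))) = Λ i := by
      simp
      field_simp
      ring
    rw [this, hP.1 i k hk, mul_zero]
  · rcases eq_or_ne P 0 with rfl | hP0
    · simp
    · refine (degree_le_natDegree).trans_lt ?_
      rw [natDegree_comp, natDegree_linear (inv_ne_zero hb), mul_one, ← degree_eq_natDegree hP0]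
      exact hP.2

theorem AffinelyAlgebraicallyIndependent.exists_aeval_ne_zero {m : ℕ} {Λ : Fin m → ℂ}
    (hΛ : AffinelyAlgebraicallyIndependent Λ) {Q : MvPolynomial (Fin m) ℚ} (hQ : Q ≠ 0) :
    ∃ a b : ℂ, b ≠ 0 ∧ MvPolynomial.aeval (fun i => a + b * Λ i) Q ≠ 0 := by
  by_contra! h
  refine hQ (hΛ Q fun a b => ?_)
  set q : ℂ[X] := MvPolynomial.aeval (fun i => C a + X * C (Λ i)) Q with hq
  have hev (b : ℂ) : q.eval b = MvPolynomial.aeval (fun i => a + b * Λ i) Q := by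
    have := AlgHom.congr_fun (MvPolynomial.comp_aeval (fun i => C a + X * C (Λ i))
      ((aeval b : ℂ[X] →ₐ[ℂ] ℂ).restrictScalars ℚ)) Q
    rw [AlgHom.comp_apply, AlgHom.restrictScalars_apply, coe_aeval_eq_eval, ← hq] at this
    rw [this]
    congr 2
    funext i
    simp [mul_comm b]
  -- The value `b = 0`, about which nothing is assumed, is absorbed by the factor `X`.
  have : X * q = 0 := Polynomial.funext fun b => by
    rcases eq_or_ne b 0 with rfl | hb
    · simp
    · simp [hev, h a b hb]
  rw [← hev, (mul_eq_zero.1 this).resolve_left X_ne_zero, eval_zero]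

/-- For affinely algebraically independent nodes the dimension of the solution space is no
larger than forced by counting conditions. -/
theorem AffinelyAlgebraicallyIndependent.finrank_vanishingSubmodule_le {m : ℕ} {Λ : Fin m → ℂ}
    (hΛ : AffinelyAlgebraicallyIndependent Λ) (B : Fin m → Finset ℕ) {j r : ℕ}
    (h : ∀ i ≤ j, i ≤ r + ∑ l, ((B l).filter (· < i)).card) :
    Module.finrank ℂ (vanishingSubmodule Λ B j) ≤ r := by
  obtain ⟨Λ₀, hΛ₀⟩ := exists_nodes_finrank_vanishingSubmodule_le B (max j r)
  have h0 := hΛ₀ j (le_max_left _ _) r (le_max_right _ _) h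
  -- A maximal nonzero minor at `Λ₀` shows that `Q ≠ 0`. Hence `Q` is nonzero at some affine image
  -- of `Λ`, where the rank is at least that at `Λ₀`.
  obtain ⟨f, g, hfg⟩ := (birkhoffMatrix Λ₀ B j).exists_submatrix_det_ne_zero
  set Q : MvPolynomial (Fin m) ℚ := ((birkhoffMatrix MvPolynomial.X B j).submatrix f g).det
  have hev (x : Fin m → ℂ) :
      MvPolynomial.aeval x Q = ((birkhoffMatrix x B j).submatrix f g).det :=
    aeval_det_submatrix_birkhoffMatrix x B j f g
  obtain ⟨a, b, hb, hab⟩ := hΛ.exists_aeval_ne_zero (Q := Q) (by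
    intro h
    rw [← hev, h, map_zero] at hfg
    exact hfg rfl)
  rw [hev] at hab
  have h1 := Matrix.rank_of_isUnit _ ((Matrix.isUnit_iff_isUnit_det _).2 (isUnit_iff_ne_zero.2 hab))
  have h2 := Matrix.rank_submatrix_le (birkhoffMatrix (fun i => a + b * Λ i) B j) f g
  have h3 := finrank_vanishingSubmodule_add_rank (fun i => a + b * Λ i) B j
  have h4 := finrank_vanishingSubmodule_add_rank Λ₀ B j
  have h5 := finrank_vanishingSubmodule_le_affine Λ B j a hb
  rw [Fintype.card_fin] at h1
  omega

/-- Each condition costs at most one dimension, and those of order at least `j` are automatic in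
degree below `j`. -/
theorem le_finrank_vanishingSubmodule_add {m : ℕ} (Λ : Fin m → ℂ) (B : Fin m → Finset ℕ) (j : ℕ) :
    j ≤ Module.finrank ℂ (vanishingSubmodule Λ B j) + ∑ l, ((B l).filter (· < j)).card := by
  have h1 : vanishingSubmodule Λ B j = vanishingSubmodule Λ (fun l => (B l).filter (· < j)) j := by
    ext P
    simp only [mem_vanishingSubmodule, Finset.mem_filter]
    refine ⟨fun h => ⟨fun i b hb => h.1 i b hb.1, h.2⟩, fun h => ⟨fun i b hb => ?_, h.2⟩⟩
    rcases lt_or_ge b j with hbj | hbj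
    · exact h.1 i b ⟨hb, hbj⟩
    · rw [iterate_derivative_eq_zero_of_degree_lt (h.2.trans_le (by exact_mod_cast hbj)), eval_zero]
  have h2 := finrank_vanishingSubmodule_add_rank Λ (fun l => (B l).filter (· < j)) j
  have h3 := (birkhoffMatrix Λ (fun l => (B l).filter (· < j)) j).rank_le_card_height
  rw [Fintype.card_sigma] at h3
  simp only [Fintype.card_coe] at h3
  rw [h1]
  omega

/-! ### Generic dope matrices are the sparse matrices. -/

/-- The zero-one matrix whose `j`-th column is the indicator vector of `c j`. -/
def indicatorMatrix {m N : ℕ} (c : Fin N → Finset (Fin m)) : Matrix (Fin m) (Fin N) ℕ :=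
  Matrix.of fun i j => if i ∈ c j then 1 else 0

theorem indicatorMatrix_injective {m N : ℕ} :
    Function.Injective (indicatorMatrix : (Fin N → Finset (Fin m)) → _) := by
  intro c c' h
  funext j
  ext i
  have := congrFun (congrFun h i) j
  simp only [indicatorMatrix, Matrix.of_apply] at this
  split_ifs at this <;> tauto

theorem numOnes_indicatorMatrix {m N : ℕ} (c : Fin N → Finset (Fin m)) :
    numOnes (indicatorMatrix c) = ∑ j, (c j).card := by
  rw [numOnes, Finset.card_filter, Fintype.sum_prod_type_right]
  refine Finset.sum_congr rfl fun j _ => ?_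
  simp [indicatorMatrix]

/-- The last `N - a` columns contain fewer than `N - a` ones, for every `a < N`. -/
def IsSparse {m N : ℕ} (c : Fin N → Finset (Fin m)) : Prop :=
  ∀ a : Fin N, ∑ j ∈ Finset.Ici a, (c j).card + a < N

/-- The positions of the ones in the `i`-th row of `indicatorMatrix c`. -/
def rowSupport {m N : ℕ} (c : Fin N → Finset (Fin m)) (i : Fin m) : Finset ℕ :=
  (Finset.univ.filter fun j => i ∈ c j).map Fin.valEmbedding

theorem mem_rowSupport {m N : ℕ} {c : Fin N → Finset (Fin m)} {i : Fin m} {b : ℕ} :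
    b ∈ rowSupport c i ↔ ∃ h : b < N, i ∈ c ⟨b, h⟩ := by
  simp only [rowSupport, Finset.mem_map, Finset.mem_filter, Finset.mem_univ, true_and,
    Fin.valEmbedding_apply]
  exact ⟨fun ⟨j, hj, hjb⟩ => hjb ▸ ⟨j.2, hj⟩, fun ⟨h, hi⟩ => ⟨⟨b, h⟩, hi, rfl⟩⟩

theorem sum_card_rowSupport_filter {m N : ℕ} (c : Fin N → Finset (Fin m)) (a : ℕ) :
    ∑ i, ((rowSupport c i).filter (· < a)).card =
      ∑ j ∈ Finset.univ.filter (fun j : Fin N => (j : ℕ) < a), (c j).card := by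
  have (i : Fin m) : ((rowSupport c i).filter (· < a)).card =
      ∑ j ∈ Finset.univ.filter (fun j : Fin N => (j : ℕ) < a), if i ∈ c j then 1 else 0 := by
    rw [rowSupport, Finset.filter_map, Finset.card_map, Finset.sum_ite, Finset.sum_const_zero,
      add_zero, ← Finset.card_eq_sum_ones, Finset.filter_filter, Finset.filter_filter]
    congr 1
    ext j
    simp [and_comm]
  rw [Finset.sum_congr rfl fun i _ => this i, Finset.sum_comm]
  refine Finset.sum_congr rfl fun j _ => ?_
  simp

theorem sum_card_rowSupport_filter_add {m N : ℕ} (c : Fin N → Finset (Fin m)) (a : Fin N) :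
    ∑ i, ((rowSupport c i).filter (· < (a : ℕ))).card + ∑ j ∈ Finset.Ici a, (c j).card =
      ∑ i, ((rowSupport c i).filter (· < N)).card := by
  rw [sum_card_rowSupport_filter, sum_card_rowSupport_filter,
    ← Finset.sum_filter_add_sum_filter_not (Finset.univ.filter fun j : Fin N => (j : ℕ) < N)
      (fun j : Fin N => (j : ℕ) < a)]
  congr 1
  · refine Finset.sum_congr ?_ fun _ _ => rfl
    ext j
    simp only [Finset.mem_filter, Finset.mem_univ, true_and, j.isLt]
  · refine Finset.sum_congr ?_ fun _ _ => rfl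
    ext j
    simp only [Finset.mem_filter, Finset.mem_univ, true_and, j.isLt, Finset.mem_Ici, Fin.le_def,
      not_lt]

theorem mem_vanishingSubmodule_rowSupport {m n : ℕ} {Λ : Fin m → ℂ}
    {c : Fin (n + 1) → Finset (Fin m)} {j : ℕ} {P : ℂ[X]} :
    P ∈ vanishingSubmodule Λ (rowSupport c) j ↔
      (∀ k : Fin (n + 1), ∀ i ∈ c k, (derivative^[(k : ℕ)] P).eval (Λ i) = 0) ∧ P.degree < j := by
  rw [mem_vanishingSubmodule]
  refine and_congr_left fun _ => ⟨fun h k i hi => h i k (mem_rowSupport.2 ⟨k.2, hi⟩),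
    fun h i b hb => ?_⟩
  obtain ⟨hbn, hi⟩ := mem_rowSupport.1 hb
  exact h ⟨b, hbn⟩ i hi

theorem finrank_vanishingSubmodule_mono {m : ℕ} (Λ : Fin m → ℂ) (B : Fin m → Finset ℕ) {i j : ℕ}
    (hij : i ≤ j) : Module.finrank ℂ (vanishingSubmodule Λ B i) ≤
      Module.finrank ℂ (vanishingSubmodule Λ B j) :=
  Submodule.finrank_mono (inf_le_inf_left _ (degreeLT_mono hij))

/-- If the columns from `a` on hold at least `n + 1 - a` ones, the counting bound for degree `< n +
1` is no larger than the dimension for degree `< n`. Then no solution has degree exactly `n`. -/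
theorem AffinelyAlgebraicallyIndependent.isSparse {m n : ℕ} {Λ : Fin m → ℂ}
    (hΛ : AffinelyAlgebraicallyIndependent Λ) {c : Fin (n + 1) → Finset (Fin m)} {P : ℂ[X]}
    (hP : P.degree = n)
    (hc : ∀ k : Fin (n + 1), ∀ i ∈ c k, (derivative^[(k : ℕ)] P).eval (Λ i) = 0) :
    IsSparse c := by
  by_contra hcon
  simp only [IsSparse, not_forall, not_lt] at hcon
  obtain ⟨a, ha⟩ := hcon
  have hsum := sum_card_rowSupport_filter_add c a
  have hlt : vanishingSubmodule Λ (rowSupport c) n < vanishingSubmodule Λ (rowSupport c) (n + 1) := by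
    refine lt_of_le_of_ne (inf_le_inf_left _ (degreeLT_mono (Nat.le_succ n))) fun h => ?_
    have hmem : P ∈ vanishingSubmodule Λ (rowSupport c) (n + 1) :=
      mem_vanishingSubmodule_rowSupport.2 ⟨hc, by rw [hP]; exact_mod_cast Nat.lt_succ_self n⟩
    rw [← h, mem_vanishingSubmodule_rowSupport, hP] at hmem
    exact lt_irrefl _ hmem.2
  refine (Submodule.finrank_lt_finrank_of_lt hlt).not_ge
    (hΛ.finrank_vanishingSubmodule_le _ fun i hi => ?_)
  have hlow (i : ℕ) (hi : i ≤ n) : i ≤ Module.finrank ℂ (vanishingSubmodule Λ (rowSupport c) n) +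
      ∑ l, ((rowSupport c l).filter (· < i)).card := by
    have h1 := le_finrank_vanishingSubmodule_add Λ (rowSupport c) i
    have h2 := finrank_vanishingSubmodule_mono Λ (rowSupport c) hi
    omega
  rcases Nat.le_succ_iff.1 hi with hi | rfl
  · exact hlow i hi
  · have := hlow a (by omega)
    simp only [Nat.succ_eq_add_one]
    omega

/-- Sparsity leaves a slack of one in the counting bound below degree `n + 1`, so either dropping
the top degree or adding one condition lowers the dimension. Thus the leading coefficient and every
derivative value that should not vanish are nonzero functionals on `V`. -/
theorem AffinelyAlgebraicallyIndependent.exists_polynomial {m n : ℕ} {Λ : Fin m → ℂ}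
    (hΛ : AffinelyAlgebraicallyIndependent Λ) {c : Fin (n + 1) → Finset (Fin m)}
    (hc : IsSparse c) :
    ∃ P : ℂ[X], P.degree = n ∧
      ∀ (k : Fin (n + 1)) (i : Fin m), (derivative^[(k : ℕ)] P).eval (Λ i) = 0 ↔ i ∈ c k := by
  set B := rowSupport c with hB
  set V := vanishingSubmodule Λ B (n + 1) with hV
  set r := Module.finrank ℂ V with hr
  have hlow : n + 1 ≤ r + _ := le_finrank_vanishingSubmodule_add Λ B (n + 1)
  have hi (i : ℕ) (hin : i ≤ n) : i + 1 ≤ r + ∑ l, ((B l).filter (· < i)).card := by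
    have h1 := hc ⟨i, by omega⟩
    have h2 := sum_card_rowSupport_filter_add c ⟨i, by omega⟩
    simp only [← hB] at h1 h2
    omega
  have hr0 : 1 ≤ r := by simpa using hi 0 (Nat.zero_le n)
  have hlead : ∃ P ∈ V, P.coeff n ≠ 0 := by
    by_contra! h
    have hle : V ≤ vanishingSubmodule Λ B n := fun P hP => by
      refine ⟨hP.1, mem_degreeLT.2 ((degree_lt_iff_coeff_zero _ _).2 fun k hk => ?_)⟩
      rcases hk.eq_or_lt with rfl | hk
      · exact h P hP
      · exact (degree_lt_iff_coeff_zero _ _).1 (mem_degreeLT.1 hP.2) k hk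
    have h1 := Submodule.finrank_mono hle
    have h2 := hΛ.finrank_vanishingSubmodule_le B (j := n) (r := r - 1) fun i hin => by
      have := hi i hin
      omega
    omega
  have hval (k : Fin (n + 1)) (i : Fin m) (hik : i ∉ c k) :
      ∃ P ∈ V, (derivative^[(k : ℕ)] P).eval (Λ i) ≠ 0 := by
    by_contra! h
    set B' := Function.update B i (insert (k : ℕ) (B i)) with hB'
    have hkB : (k : ℕ) ∉ B i := fun hk => hik (mem_rowSupport.1 hk).2
    have hsub (l : Fin m) : B l ⊆ B' l := by
      rcases eq_or_ne l i with rfl | hl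
      · simp [hB']
      · simp [hB', hl]
    have hle : V ≤ vanishingSubmodule Λ B' (n + 1) := fun P hP => by
      have hP' := mem_vanishingSubmodule.1 hP
      refine mem_vanishingSubmodule.2 ⟨fun l b hb => ?_, hP'.2⟩
      rcases eq_or_ne l i with rfl | hl
      · rw [hB', Function.update_self, Finset.mem_insert] at hb
        rcases hb with rfl | hb
        exacts [h P hP, hP'.1 _ _ hb]
      · rw [hB', Function.update_of_ne hl] at hb
        exact hP'.1 _ _ hb
    have hsum : ∑ l, ((B l).filter (· < n + 1)).card < ∑ l, ((B' l).filter (· < n + 1)).card := by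
      refine Finset.sum_lt_sum
        (fun l _ => Finset.card_le_card (Finset.filter_subset_filter _ (hsub l)))
        ⟨i, Finset.mem_univ i, Finset.card_lt_card ?_⟩
      refine (Finset.ssubset_iff_of_subset (Finset.filter_subset_filter _ (hsub i))).2
        ⟨k, ?_, fun hk => hkB (Finset.mem_filter.1 hk).1⟩
      exact Finset.mem_filter.2 ⟨by simp [hB'], k.isLt⟩
    have h1 := Submodule.finrank_mono hle
    have h2 := hΛ.finrank_vanishingSubmodule_le B' (j := n + 1) (r := r - 1) fun i hin => by
      rcases Nat.le_succ_iff.1 hin with hin | rfl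
      · have h3 := hi i hin
        have h4 : ∑ l, ((B l).filter (· < i)).card ≤ ∑ l, ((B' l).filter (· < i)).card :=
          Finset.sum_le_sum fun l _ =>
            Finset.card_le_card (Finset.filter_subset_filter _ (hsub l))
        omega
      · simp only [Nat.succ_eq_add_one]
        omega
    omega
  -- Over an infinite field finitely many proper subspaces do not cover `V`; `none` indexes the
  -- leading coefficient.
  obtain ⟨P, hPV, hP⟩ := Module.Dual.exists_forall_mem_ne_zero_of_forall_exists V
    (fun o : Option {p : Fin (n + 1) × Fin m // p.2 ∉ c p.1} => o.elim (lcoeff ℂ n)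
      fun p => leval (Λ p.1.2) ∘ₗ derivative ^ (p.1.1 : ℕ)) (by
      rintro (_ | ⟨⟨k, i⟩, hik⟩)
      · simpa using hlead
      · simpa [Module.End.pow_apply] using hval k i hik)
  have hPV' := mem_vanishingSubmodule_rowSupport.1 hPV
  refine ⟨P, ?_, fun k i => ⟨fun h => ?_, fun h => hPV'.1 k i h⟩⟩
  · refine degree_eq_of_le_of_coeff_ne_zero ?_ (by simpa using hP none)
    rw [degree_le_iff_coeff_zero]
    intro k hk
    exact (degree_lt_iff_coeff_zero _ _).1 hPV'.2 k (by exact_mod_cast hk)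
  · by_contra hik
    exact hP (some ⟨(k, i), hik⟩) (by simpa [Module.End.pow_apply] using h)

/-- Pólya-type description of the generic dope matrices. -/
theorem AffinelyAlgebraicallyIndependent.dopeSet_eq {m n : ℕ} {Λ : Fin m → ℂ}
    (hΛ : AffinelyAlgebraicallyIndependent Λ) :
    dopeSet n Λ = indicatorMatrix '' {c | IsSparse c} := by
  classical
  ext M
  constructor
  · rintro ⟨P, hP, rfl⟩
    refine ⟨fun k => Finset.univ.filter fun i => (derivative^[(k : ℕ)] P).eval (Λ i) = 0,
      hΛ.isSparse hP fun k i hi => (Finset.mem_filter.1 hi).2, ?_⟩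
    ext i j
    simp [indicatorMatrix, dopeMatrix]
  · rintro ⟨c, hc, rfl⟩
    obtain ⟨P, hP, h⟩ := hΛ.exists_polynomial hc
    refine ⟨P, hP, ?_⟩
    ext i j
    simp [indicatorMatrix, dopeMatrix, h]

/-- A transcendence basis of `ℂ` over `ℚ` is infinite, and any `m` of its elements serve, already
with `a = 0`, `b = 1`. -/
theorem exists_affinelyAlgebraicallyIndependent (m : ℕ) :
    ∃ Λ : Fin m → ℂ, AffinelyAlgebraicallyIndependent Λ := by
  obtain ⟨s, hs⟩ := exists_isTranscendenceBasis ℚ ℂ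
  have hcard := IsAlgClosed.cardinal_eq_cardinal_transcendence_basis_of_aleph0_lt _ hs
    Cardinal.mk_le_aleph0 (by rw [Cardinal.mk_complex]; exact Cardinal.aleph0_lt_continuum)
  have : Infinite s := by
    rw [Cardinal.infinite_iff, ← Cardinal.lift_id (Cardinal.mk s), ← hcard, Cardinal.mk_complex]
    simpa using Cardinal.aleph0_le_continuum
  obtain ⟨f⟩ : Nonempty (Fin m ↪ s) := ⟨Fin.valEmbedding.trans (Infinite.natEmbedding s)⟩
  refine ⟨fun i => f i, fun Q hQ => ?_⟩
  have := (hs.1.comp f f.injective)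
  refine (injective_iff_map_eq_zero _).1 this Q ?_
  simpa [Function.comp_def] using hQ 0 1

theorem genericDopeSet_eq (m n : ℕ) :
    genericDopeSet m n = indicatorMatrix '' {c | IsSparse c} := by
  ext M
  constructor
  · rintro ⟨Λ, hΛ, hM⟩
    rwa [hΛ.dopeSet_eq] at hM
  · intro hM
    obtain ⟨Λ, hΛ⟩ := exists_affinelyAlgebraicallyIndependent m
    exact ⟨Λ, hΛ, by rwa [hΛ.dopeSet_eq]⟩

/-! ### Counting sparse matrices. -/

/-- Sparsity constrains final blocks of columns, so a new first column adds only the constraint on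
the total. -/
theorem isSparse_cons_iff {m N : ℕ} (A : Finset (Fin m)) (c : Fin N → Finset (Fin m)) :
    IsSparse (Fin.cons A c : Fin (N + 1) → Finset (Fin m)) ↔
      IsSparse c ∧ A.card + ∑ j, (c j).card ≤ N := by
  rw [IsSparse, Fin.forall_fin_succ, and_comm]
  refine and_congr (forall_congr' fun a => ?_) ?_
  · rw [Fin.sum_Ici_succ]
    simp only [Fin.cons_succ, Fin.val_succ]
    omega
  · have : Finset.Ici (0 : Fin (N + 1)) = Finset.univ := by ext; simp
    rw [this, Fin.sum_univ_succ]
    simp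

theorem IsSparse.sum_card_le {m n : ℕ} {c : Fin (n + 1) → Finset (Fin m)} (hc : IsSparse c) :
    ∑ j, (c j).card ≤ n := by
  rw [← Fin.cons_self_tail c, isSparse_cons_iff] at hc
  rw [Fin.sum_univ_succ]
  exact hc.2

open Classical in
/-- The number of sparse `m × N` zero-one matrices with exactly `k` ones. -/
noncomputable def sparseCount (m N k : ℕ) : ℕ :=
  (Finset.univ.filter fun c : Fin N → Finset (Fin m) =>
    IsSparse c ∧ ∑ j, (c j).card = k).card

theorem sparseCount_eq_zero_of_lt {m n k : ℕ} (h : n < k) : sparseCount m (n + 1) k = 0 := by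
  classical
  rw [sparseCount, Finset.card_eq_zero, Finset.filter_eq_empty_iff]
  rintro c - ⟨hc, hk⟩
  have := hc.sum_card_le
  omega

theorem sparseCount_zero (m : ℕ) : sparseCount m 0 0 = 1 := by
  classical
  rw [sparseCount, Finset.filter_true_of_mem]
  · simp
  · intro c _
    exact ⟨fun a => a.elim0, by simp⟩

/-- For `k ≤ N` the constraint on the total is automatic, leaving the first column free. -/
theorem sparseCount_succ {m N k : ℕ} (hk : k ≤ N) :
    sparseCount m (N + 1) k =
      ∑ x ∈ Finset.HasAntidiagonal.antidiagonal k, m.choose x.1 * sparseCount m N x.2 := by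
  classical
  have hchoose (a : ℕ) :
      m.choose a = ∑ A : Finset (Fin m), if A.card = a then 1 else 0 := by
    rw [← Finset.card_filter, ← Fintype.card_subtype, Fintype.card_finset_len, Fintype.card_fin]
  have hcount (N b : ℕ) : sparseCount m N b = ∑ c : Fin N → Finset (Fin m),
      if IsSparse c ∧ ∑ j, (c j).card = b then 1 else 0 := by
    rw [sparseCount, Finset.card_filter]
  simp only [hcount, hchoose, Finset.sum_mul_sum]
  rw [Finset.sum_comm, ← (Fin.consEquiv fun _ => Finset (Fin m)).sum_comp, Fintype.sum_prod_type]
  refine Finset.sum_congr rfl fun A _ => ?_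
  rw [Finset.sum_comm]
  refine Finset.sum_congr rfl fun c _ => ?_
  have hx (x : ℕ × ℕ) : ((if A.card = x.1 then 1 else 0) *
      if IsSparse c ∧ ∑ j, (c j).card = x.2 then 1 else 0) =
      if (A.card, ∑ j, (c j).card) = x then (if IsSparse c then 1 else 0) else 0 := by
    obtain ⟨a, b⟩ := x
    simp only [Prod.mk.injEq]
    split_ifs <;> first | rfl | tauto
  simp only [hx, Finset.sum_ite_eq, Finset.HasAntidiagonal.mem_antidiagonal]
  change (if IsSparse (Fin.cons A c : Fin (N + 1) → Finset (Fin m)) ∧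
    ∑ j, ((Fin.cons A c : Fin (N + 1) → Finset (Fin m)) j).card = k then 1 else 0) = _
  rw [isSparse_cons_iff, Fin.sum_univ_succ]
  simp only [Fin.cons_zero, Fin.cons_succ]
  by_cases hS : IsSparse c <;> by_cases hk' : A.card + ∑ j, (c j).card = k <;> simp [hS, hk', hk]

/-- Vandermonde after absorbing the weight, `b * L.choose b = L * (L - 1).choose (b - 1)`; the
factor `m + L` avoids division. -/
theorem sum_antidiagonal_choose_mul_mul_choose (m L k : ℕ) :
    (m + L) * ∑ x ∈ Finset.HasAntidiagonal.antidiagonal k, m.choose x.1 * (x.2 * L.choose x.2) =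
      L * (k * (m + L).choose k) := by
  rcases k with _ | k
  · simp
  rcases L with _ | L
  · rw [Finset.sum_eq_zero, mul_zero, zero_mul]
    rintro ⟨a, b⟩ -
    rcases b with _ | b <;> simp
  rw [Finset.Nat.antidiagonal_succ', Finset.sum_cons, Finset.sum_map]
  have h (b : ℕ) : (b + 1) * (L + 1).choose (b + 1) = (L + 1) * L.choose b := by
    rw [Nat.add_one_mul_choose_eq, mul_comm]
  have hv := Nat.add_choose_eq m L k
  have hs := Nat.add_one_mul_choose_eq (m + L) k
  simp only [Function.Embedding.prodMap, Function.Embedding.coeFn_mk, Prod.map,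
    Function.Embedding.refl_apply, zero_mul, mul_zero, zero_add, Nat.succ_eq_add_one, h]
  have hsum : ∑ x ∈ Finset.HasAntidiagonal.antidiagonal k, m.choose x.1 * ((L + 1) * L.choose x.2) =
      (L + 1) * (m + L).choose k := by
    rw [hv, Finset.mul_sum]
    exact Finset.sum_congr rfl fun x _ => by ring
  rw [hsum, ← add_assoc, mul_comm (k + 1), ← hs]
  ring

theorem succ_mul_sparseCount {m : ℕ} (hm : 1 ≤ m) (n : ℕ) {k : ℕ} (hk : k ≤ n + 1) :
    ((n : ℚ) + 1) * sparseCount m (n + 1) k = (n + 1 - k) * ((n + 1) * m).choose k := by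
  induction n generalizing k with
  | zero =>
    interval_cases k
    · rw [sparseCount_succ le_rfl]
      simp [sparseCount_zero]
    · simp [sparseCount_eq_zero_of_lt]
  | succ n ih =>
    -- At `k = n + 2` the recursion is unavailable, but both sides vanish.
    rcases hk.eq_or_lt with rfl | hk
    · rw [sparseCount_eq_zero_of_lt (Nat.lt_succ_self _)]
      push_cast
      ring
    · have hkn : k ≤ n + 1 := Nat.lt_succ_iff.1 hk
      have hrec : ((n : ℚ) + 1) * sparseCount m (n + 1 + 1) k =
          (n + 1) * ∑ x ∈ Finset.HasAntidiagonal.antidiagonal k,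
            (m.choose x.1 * ((n + 1) * m).choose x.2 : ℚ) -
          ∑ x ∈ Finset.HasAntidiagonal.antidiagonal k,
            (m.choose x.1 * (x.2 * ((n + 1) * m).choose x.2) : ℚ) := by
        rw [sparseCount_succ hkn]
        push_cast
        rw [Finset.mul_sum, Finset.mul_sum, ← Finset.sum_sub_distrib]
        refine Finset.sum_congr rfl fun x hx => ?_
        have := ih (k := x.2) (by
          have := Finset.HasAntidiagonal.mem_antidiagonal.1 hx
          omega)
        linear_combination (m.choose x.1 : ℚ) * this
      have hv : ∑ x ∈ Finset.HasAntidiagonal.antidiagonal k, (m.choose x.1 * ((n + 1) * m).choose x.2 : ℚ) =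
          ((n + 1 + 1) * m).choose k := by
        rw [show (n + 1 + 1) * m = m + (n + 1) * m by ring, Nat.add_choose_eq]
        push_cast
        rfl
      have hw := congrArg (Nat.cast : ℕ → ℚ)
        (sum_antidiagonal_choose_mul_mul_choose m ((n + 1) * m) k)
      rw [show m + (n + 1) * m = (n + 1 + 1) * m by ring] at hw
      push_cast at hw
      rw [hv] at hrec
      have hm0 : (m : ℚ) ≠ 0 := by positivity
      have hn0 : (n : ℚ) + 1 ≠ 0 := by positivity
      push_cast
      refine mul_left_cancel₀ (mul_ne_zero hm0 hn0) ?_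
      linear_combination (n + 1 + 1) * (m : ℚ) * hrec - hw

/-- With `L = (n + 1) * m - 1`, Pascal and absorption turn the `k`-th summand into `L.choose k - (m
- 1) * L.choose (k - 1)` for `k ≥ 1`, and the partial sums follow. -/
theorem sum_range_sparseCount {m : ℕ} (hm : 1 ≤ m) (n i : ℕ) (hi : i ≤ n) :
    ∑ k ∈ Finset.range (i + 1), (sparseCount m (n + 1) k : ℚ) =
      (((n + 1) * m - 1).choose i : ℚ) -
        ((m : ℚ) - 2) * ∑ k ∈ Finset.range i, (((n + 1) * m - 1).choose k : ℚ) := by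
  obtain ⟨L, hL⟩ : ∃ L, (n + 1) * m = L + 1 :=
    ⟨(n + 1) * m - 1, (Nat.sub_add_cancel (Nat.mul_pos n.succ_pos hm)).symm⟩
  have hn0 : (n : ℚ) + 1 ≠ 0 := by positivity
  rw [hL, Nat.add_sub_cancel]
  induction i with
  | zero =>
    have := succ_mul_sparseCount hm n (Nat.zero_le _)
    refine mul_left_cancel₀ hn0 ?_
    simpa using this
  | succ i ih =>
    have h1 := succ_mul_sparseCount hm n (k := i + 1) (by omega)
    have h2 := congrArg (Nat.cast : ℕ → ℚ) (Nat.add_one_mul_choose_eq L i)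
    have h3 := congrArg (Nat.cast : ℕ → ℚ) hL
    rw [hL, Nat.choose_succ_succ'] at h1
    rw [Nat.choose_succ_succ'] at h2
    push_cast at h1 h2 h3
    rw [Finset.sum_range_succ, ih (by omega), Finset.sum_range_succ]
    refine mul_left_cancel₀ hn0 ?_
    linear_combination h1 + h2 + (L.choose i : ℚ) * h3

/-! ### Cardinalities of the generic dope sets. -/

theorem setOf_mem_genericDopeSet_numOnes_eq (m n k : ℕ) :
    {M ∈ genericDopeSet m n | numOnes M = k} =
      indicatorMatrix '' {c | IsSparse c ∧ ∑ j, (c j).card = k} := by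
  ext M
  rw [genericDopeSet_eq]
  constructor
  · rintro ⟨⟨c, hc, rfl⟩, hk⟩
    exact ⟨c, ⟨hc, by rwa [← numOnes_indicatorMatrix]⟩, rfl⟩
  · rintro ⟨c, ⟨hc, hk⟩, rfl⟩
    exact ⟨⟨c, hc, rfl⟩, by rwa [numOnes_indicatorMatrix]⟩

theorem ncard_genericDopeSet_numOnes_eq (m n k : ℕ) :
    {M ∈ genericDopeSet m n | numOnes M = k}.ncard = sparseCount m (n + 1) k := by
  classical
  rw [setOf_mem_genericDopeSet_numOnes_eq, Set.ncard_image_of_injective _ indicatorMatrix_injective,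
    sparseCount, ← Set.ncard_coe_finset]
  simp

theorem ncard_genericDopeSet (m n : ℕ) :
    (genericDopeSet m n).ncard = ∑ k ∈ Finset.range (n + 1), sparseCount m (n + 1) k := by
  classical
  have h : (genericDopeSet m n).ncard =
      (Finset.univ.filter fun c : Fin (n + 1) → Finset (Fin m) => IsSparse c).card := by
    rw [genericDopeSet_eq, Set.ncard_image_of_injective _ indicatorMatrix_injective,
      ← Set.ncard_coe_finset]
    simp
  rw [h, Finset.card_eq_sum_card_fiberwise (f := fun c => ∑ j, (c j).card)
    (t := Finset.range (n + 1))]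
  · refine Finset.sum_congr rfl fun k _ => ?_
    rw [sparseCount, Finset.filter_filter]
  · intro c hc
    have hc' : IsSparse c := by simpa using hc
    simpa [Nat.lt_succ_iff] using hc'.sum_card_le

/-- Finiteness is asserted separately because `Set.ncard` is `0` on infinite sets. The total is
stated in `ℤ` since `m - 2` is negative for `m = 1`. -/
theorem theorem2 (m n : ℕ) (hm : 1 ≤ m) :
    (∀ Λ : Fin m → ℂ, AffinelyAlgebraicallyIndependent Λ → dopeSet n Λ = genericDopeSet m n) ∧
    (∀ k : ℕ, k ≤ n + 1 →
      (({M ∈ genericDopeSet m n | numOnes M = k}.ncard : ℕ) : ℚ) =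
        ((n : ℚ) + 1 - (k : ℚ)) / ((n : ℚ) + 1) * (((n + 1) * m).choose k : ℚ)) ∧
    (∀ k : ℕ, n < k → {M ∈ genericDopeSet m n | numOnes M = k} = ∅) ∧
    (genericDopeSet m n).Finite ∧
    (((genericDopeSet m n).ncard : ℕ) : ℤ) =
      (((n + 1) * m - 1).choose n : ℤ) -
        ((m : ℤ) - 2) * ∑ k ∈ Finset.range n, (((n + 1) * m - 1).choose k : ℤ) := by
  refine ⟨fun Λ hΛ => by rw [hΛ.dopeSet_eq, genericDopeSet_eq], fun k hk => ?_, fun k hk => ?_, ?_,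
    ?_⟩
  · rw [ncard_genericDopeSet_numOnes_eq]
    have hn0 : (n : ℚ) + 1 ≠ 0 := by positivity
    rw [div_mul_eq_mul_div, eq_div_iff hn0, ← succ_mul_sparseCount hm n hk, mul_comm]
  · rw [setOf_mem_genericDopeSet_numOnes_eq, Set.image_eq_empty, Set.eq_empty_iff_forall_notMem]
    rintro c ⟨hc, hk'⟩
    have := hc.sum_card_le
    omega
  · rw [genericDopeSet_eq]
    exact (Set.toFinite _).image _
  · have := sum_range_sparseCount hm n n le_rfl
    rw [ncard_genericDopeSet]
    exact_mod_cast this
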